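/- Let $\mathbb{K}$ be a field, let $\mathcal{C}$ be a clutter on a finite vertex set $V$ (a set of subsets of $V$, called edges, none of which contains another), and suppose that $\mathcal{C}$ is $k$-uniform, i.e. every edge has exactly $k$ elements. Let $I(\mathcal{C})=\big(\prod_{v\in e}x_v : e \text{ an edge of } \mathcal{C}\big)$ be the edge ideal of $\mathcal{C}$ in $S=\mathbb{K}[x_v : v\in V]$. Let $t$ be the induced matching number of $\mathcal{C}$, that is, the maximum cardinality of a set $M$ of pairwise disjoint edges such that the members of $M$ are the only edges of $\mathcal{C}$ contained in $\bigcup_{e\in M}e$. For a monomial ideal $J\subseteq S$ and $\mathbf{a}\in\mathbb{Z}^V$, let $\beta_{i,\mathbf{a}}(J)$ be the number of basis elements of degree $\mathbf{a}$ in the $i$-th module $F_i$ of a minimal $\mathbb{Z}^V$-graded free resolution $\cdots\to F_1\to F_0\to J\to 0$, and let $\beta_{i,j}(J)=\sum_{|\mathbf{a}|=j}\beta_{i,\mathbf{a}}(J)$, where $|\mathbf{a}|=\sum_{v\in V}a_v$. Then for every integer $s\geq 2$, $$\beta_{1,ks+k}(I(\mathcal{C})^s)\;\geq\; 2\binom{t}{2}\qquad\text{and}\qquad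 \beta_{2,ks+2k}(I(\mathcal{C})^s)\;\geq\; 3\binom{t}{3}.$$ -/

import Mathlib

/-- A clutter on the finite vertex set `V`: a set of subsets of `V` (the edges),
none of which contains another. -/
structure Clutter (V : Type*) where
  edges : Finset (Finset V)
  antichain : IsAntichain (· ⊆ ·) (edges : Set (Finset V))

namespace Clutter

variable {V : Type*}

/-- Every edge has cardinality `k`. -/
def IsUniform (C : Clutter V) (k : ℕ) : Prop :=
  ∀ e ∈ C.edges, e.card = k

/-- A set `M` of pairwise disjoint edges such that the members of `M` are the only edges
contained in the union of `M`. -/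
def IsInducedMatching (C : Clutter V) (M : Finset (Finset V)) : Prop :=
  M ⊆ C.edges ∧
    (∀ e ∈ M, ∀ f ∈ M, e ≠ f → Disjoint e f) ∧
    ∀ e ∈ C.edges, (e : Set V) ⊆ ⋃ f ∈ M, (f : Set V) → e ∈ M

/-- The maximum cardinality of an induced matching (these cardinalities are bounded by the
number of edges). -/
noncomputable def inducedMatchingNumber (C : Clutter V) : ℕ :=
  sSup {n | ∃ M, C.IsInducedMatching M ∧ M.card = n}

/-- The edge ideal, generated by the square-free monomials of the edges. -/
noncomputable def edgeIdeal (K : Type*) [Field K] (C : Clutter V) :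
    Ideal (MvPolynomial V K) :=
  Ideal.span {f | ∃ e ∈ C.edges, f = ∏ v ∈ e, MvPolynomial.X v}

end Clutter

namespace MonomialResolution

open MvPolynomial

variable {V K : Type*} [Field K]

/-- The polynomial `f` is homogeneous of degree `b` for the `ℤ^V`-grading of the
polynomial ring (the zero polynomial is homogeneous of every degree). -/
def IsMultihomogeneous (f : MvPolynomial V K) (b : V → ℤ) : Prop :=
  ∀ c ∈ f.support, ∀ v, (c v : ℤ) = b v

/-- The element `f` of the graded free module `⨁ q, S(-a q)` is homogeneous of degree `b`,
where `S` is the polynomial ring: its component in `S(-a q)` has degree `b - a q` in `S`. -/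
def IsHomogeneousElement {r : ℕ} (a : Fin r → V → ℤ) (f : Fin r → MvPolynomial V K)
    (b : V → ℤ) : Prop :=
  ∀ q, IsMultihomogeneous (f q) (b - a q)

/-- A minimal `ℤ^V`-graded free resolution
`⋯ → F₂ → F₁ → F₀ → J → 0` of an ideal `J` of the polynomial ring `S`, with
`F i = ⨁ p, S(-deg i p)` of finite rank. The maps are graded, that is, each basis element
`p` of `F i` is sent to a homogeneous element of the same degree `deg i p`. Minimality is the
usual condition that each differential maps into `𝔪 F`, where `𝔪` is generated by the
variables. -/
structure MinimalFreeResolution (J : Ideal (MvPolynomial V K)) where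
  /-- The rank of `F i`. -/
  rank : ℕ → ℕ
  /-- The degrees of the basis elements of `F i`. -/
  deg : (i : ℕ) → Fin (rank i) → V → ℤ
  /-- The augmentation `F 0 → J ⊆ S`. -/
  aug : (Fin (rank 0) → MvPolynomial V K) →ₗ[MvPolynomial V K] MvPolynomial V K
  /-- The differential `F (i + 1) → F i`. -/
  d : (i : ℕ) → (Fin (rank (i + 1)) → MvPolynomial V K) →ₗ[MvPolynomial V K]
    (Fin (rank i) → MvPolynomial V K)
  aug_graded : ∀ p, IsMultihomogeneous (aug (Pi.single p 1)) (deg 0 p)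
  d_graded : ∀ i p, IsHomogeneousElement (deg i) (d i (Pi.single p 1)) (deg (i + 1) p)
  range_aug : LinearMap.range aug = J
  exact_zero : Function.Exact (d 0) aug
  exact_succ : ∀ i, Function.Exact (d (i + 1)) (d i)
  minimal : ∀ i p q, constantCoeff (d i (Pi.single p 1) q) = 0

/-- The multigraded Betti number `β_{i,a}(J)` of a monomial ideal `J`: the number of basis
elements of degree `a` in the `i`-th module of a minimal graded free resolution of `J`. This
number is the same for all such resolutions; the infimum only serves to name it. -/
noncomputable def multigradedBetti (J : Ideal (MvPolynomial V K)) (i : ℕ) (a : V → ℤ) : ℕ :=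
  sInf {n | ∃ F : MinimalFreeResolution J, n = Set.ncard {p | F.deg i p = a}}

/-- The `ℤ`-graded Betti number `β_{i,j}(J) = ∑_{|a| = j} β_{i,a}(J)`, a sum with finitely
many nonzero terms. -/
noncomputable def gradedBetti [Fintype V] (J : Ideal (MvPolynomial V K)) (i : ℕ) (j : ℤ) : ℕ :=
  ∑ᶠ (a : V → ℤ) (_ : ∑ v, a v = j), multigradedBetti J i a

end MonomialResolution

/-! Let `M` be an induced matching with t edges, e ∈ M and P ⊆ M \ {e} with |P| = r, where r is 1 or
2. The multidegree a of x_e^s ∏_{f ∈ P} x_f carries a basis element of F_r in every minimal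
resolution F of I^s (`Clutter.IsInducedMatching.exists_deg_one_eq`,
`Clutter.IsInducedMatching.exists_deg_two_eq`). There are t · C(t-1, r) = (r+1) · C(t, r+1) such
pairs (e, P). Since s ≥ 2, the exponents s and 1 tell e from P, so the multidegrees are distinct.
All have total degree ks + rk, and counting them gives both bounds.

For the nonvanishing, put all variables equal to 1. The part of F in degree b becomes the complex
over K spanned by the basis elements of degree at most b, still exact (`exists_dehom_eq`), with an
augmentation to K that is onto when x^b ∈ J. Suppose F_r has no basis element of degree a. Then its
basis elements of degree at most a are covered by the sets `belowAt T a`, where T runs over the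
edges of {e} ∪ P, because these edges cover the support of a.

This is a nerve argument: the intersection of any r of these r + 1 sets contains the degree of a
monomial of I^s, as x_e^(s-1) x_g with g ∈ {e} ∪ P is a product of s edges. The intersection of all
of them contains none (`Clutter.IsInducedMatching.not_hasMonomial`). Such a cover looks like the
boundary of an r-simplex and has a nonzero cycle, against exactness in degree a. The chase is
carried out by hand in `MinimalFreeResolution.exists_deg_one_eq` and
`MinimalFreeResolution.exists_deg_two_eq`. -/

namespace MonomialResolution

open MvPolynomial

/-! ### Multihomogeneous polynomials and evaluation at the all-ones point. -/

section Components

variable {V K : Type*} [Field K]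

lemma IsMultihomogeneous.zero (b : V → ℤ) : IsMultihomogeneous (0 : MvPolynomial V K) b := by
  intro c hc; simp at hc

lemma isMultihomogeneous_monomial {m : V →₀ ℕ} {b : V → ℤ} (h : ∀ v, (m v : ℤ) = b v) (r : K) :
    IsMultihomogeneous (monomial m r) b := by
  classical
  intro c hc v
  rw [mem_support_iff, coeff_monomial] at hc
  have : m = c := by by_contra h'; simp [h'] at hc
  rw [← this, h]

lemma IsMultihomogeneous.eq_monomial {f : MvPolynomial V K} {b : V → ℤ}
    (hf : IsMultihomogeneous f b) (h0 : f ≠ 0) :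
    ∃ (m : V →₀ ℕ) (r : K), r ≠ 0 ∧ (∀ v, (m v : ℤ) = b v) ∧ f = monomial m r := by
  classical
  obtain ⟨m, hm⟩ : f.support.Nonempty := by
    rw [Finset.nonempty_iff_ne_empty]; simpa using h0
  refine ⟨m, coeff m f, mem_support_iff.1 hm, hf m hm, ?_⟩
  ext c
  rw [coeff_monomial]
  split_ifs with h
  · rw [h]
  · by_contra hc
    apply h
    ext v
    have := (hf m hm v).trans (hf c (mem_support_iff.2 hc) v).symm
    exact_mod_cast this

/-- Evaluation of a polynomial at the point with all coordinates one. -/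
noncomputable def evalOne : MvPolynomial V K →+* K := eval (fun _ => 1)

lemma evalOne_monomial (m : V →₀ ℕ) (r : K) : evalOne (monomial m r) = r := by
  simp [evalOne, eval_monomial]

lemma evalOne_C (r : K) : evalOne (C r : MvPolynomial V K) = r := by
  simp [evalOne]

/-- In the fine grading a homogeneous polynomial is a single term, so evaluation at ones only
forgets its exponent. -/
lemma IsMultihomogeneous.eq_zero {f : MvPolynomial V K} {b : V → ℤ}
    (hf : IsMultihomogeneous f b) (h : evalOne f = 0) : f = 0 := by
  by_contra h0
  obtain ⟨m, r, hr, -, rfl⟩ := hf.eq_monomial h0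
  exact hr (by rwa [evalOne_monomial] at h)

lemma IsMultihomogeneous.nonneg {f : MvPolynomial V K} {b : V → ℤ}
    (hf : IsMultihomogeneous f b) (h0 : f ≠ 0) : 0 ≤ b := by
  obtain ⟨m, r, -, hm, -⟩ := hf.eq_monomial h0
  intro v
  rw [← hm]
  exact Int.natCast_nonneg _

end Components

/-! ### Dehomogenised maps of graded free modules and vectors supported in given degrees. -/

section FreeModules

variable {V K : Type*} [Field K]

/-- A linear map of graded free modules that sends basis elements to homogeneous elements of
the same degree. -/
def IsGradedMap {m n : ℕ} (a' : Fin m → V → ℤ) (a : Fin n → V → ℤ)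
    (φ : (Fin m → MvPolynomial V K) →ₗ[MvPolynomial V K] (Fin n → MvPolynomial V K)) : Prop :=
  ∀ p, IsHomogeneousElement a (φ (Pi.single p 1)) (a' p)

lemma map_apply_eq_sum {m n : ℕ}
    (φ : (Fin m → MvPolynomial V K) →ₗ[MvPolynomial V K] (Fin n → MvPolynomial V K))
    (X : Fin m → MvPolynomial V K) (q : Fin n) :
    φ X q = ∑ p, X p * φ (Pi.single p 1) q := by
  rw [LinearMap.pi_apply_eq_sum_univ φ X, Finset.sum_apply]
  refine Finset.sum_congr rfl fun p _ => ?_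
  have : (fun j => if p = j then (1 : MvPolynomial V K) else 0) = Pi.single p 1 := by
    funext j; simp [Pi.single_apply, eq_comm]
  simp [this]

variable {l m n : ℕ} {c : Fin l → V → ℤ} {a' : Fin m → V → ℤ} {a : Fin n → V → ℤ}
  {ψ : (Fin l → MvPolynomial V K) →ₗ[MvPolynomial V K] (Fin m → MvPolynomial V K)}
  {φ : (Fin m → MvPolynomial V K) →ₗ[MvPolynomial V K] (Fin n → MvPolynomial V K)}

/-- The matrix of a map of free modules, evaluated at the point with all coordinates one. -/
noncomputable def dehom
    (φ : (Fin m → MvPolynomial V K) →ₗ[MvPolynomial V K] (Fin n → MvPolynomial V K)) :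
    (Fin m → K) →ₗ[K] (Fin n → K) :=
  LinearMap.pi fun q => ∑ p, (evalOne (φ (Pi.single p 1) q)) • LinearMap.proj p

lemma dehom_apply (x : Fin m → K) (q : Fin n) :
    dehom φ x q = ∑ p, evalOne (φ (Pi.single p 1) q) * x p := by
  simp [dehom]

lemma dehom_evalOne (X : Fin m → MvPolynomial V K) :
    dehom φ (fun p => evalOne (X p)) = fun q => evalOne (φ X q) := by
  funext q
  rw [dehom_apply, map_apply_eq_sum, map_sum]
  refine Finset.sum_congr rfl fun p _ => ?_
  rw [map_mul, mul_comm]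

lemma dehom_dehom (h : ∀ X, φ (ψ X) = 0) (x : Fin l → K) : dehom φ (dehom ψ x) = 0 := by
  have hx : x = fun p => evalOne (C (x p) : MvPolynomial V K) := by simp [evalOne_C]
  rw [hx, dehom_evalOne, dehom_evalOne, h]
  funext; simp

/-- The vectors supported on the basis elements with degrees in `P`. -/
def degreeSupported (K : Type*) [Field K] {r : ℕ} (a : Fin r → V → ℤ) (P : Set (V → ℤ)) :
    Submodule K (Fin r → K) where
  carrier := {x | ∀ p, a p ∉ P → x p = 0}
  zero_mem' := by simp
  add_mem' := by
    intro x y hx hy p hp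
    simp [hx p hp, hy p hp]
  smul_mem' := by
    intro r x hx p hp
    simp [hx p hp]

lemma degreeSupported_mono {r : ℕ} {a : Fin r → V → ℤ} {P Q : Set (V → ℤ)} (h : P ⊆ Q) :
    degreeSupported K a P ≤ degreeSupported K a Q :=
  fun _ hx p hp => hx p fun h' => hp (h h')

lemma mem_degreeSupported_inter {r : ℕ} {a : Fin r → V → ℤ} {P Q : Set (V → ℤ)} {x : Fin r → K}
    (hP : x ∈ degreeSupported K a P) (hQ : x ∈ degreeSupported K a Q) :
    x ∈ degreeSupported K a (P ∩ Q) := by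
  intro p hp
  by_cases h : a p ∈ P
  · exact hQ p fun h' => hp ⟨h, h'⟩
  · exact hP p h

lemma exists_add_of_mem_union {r : ℕ} {a : Fin r → V → ℤ} {P Q : Set (V → ℤ)} {x : Fin r → K}
    (hx : x ∈ degreeSupported K a (P ∪ Q)) :
    ∃ y ∈ degreeSupported K a P, ∃ z ∈ degreeSupported K a Q, x = y + z := by
  classical
  refine ⟨fun p => if a p ∈ P then x p else 0, fun p hp => by simp [hp],
    fun p => if a p ∈ P then 0 else x p, fun p hp => ?_, ?_⟩
  · by_cases h : a p ∈ P
    · simp [h]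
    · simpa [h] using hx p (by simp [h, hp])
  · funext p
    by_cases h : a p ∈ P <;> simp [h]

lemma IsHomogeneousElement.evalOne_mem {b : V → ℤ} {X : Fin n → MvPolynomial V K}
    (hX : IsHomogeneousElement a X b) :
    (fun q => evalOne (X q)) ∈ degreeSupported K a (Set.Iic b) := by
  intro q hq
  by_contra h
  apply hq
  have := (hX q).nonneg (fun h0 => h (by simp [h0]))
  exact sub_nonneg.1 this

/-- A nonzero matrix entry from p to q is a monomial of degree `a' p - a q`, which forces `a q ≤ a'
p`. Hence each lower set of degrees cuts out a subcomplex. -/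
lemma IsGradedMap.dehom_mem (hφ : IsGradedMap a' a φ) {P : Set (V → ℤ)} (hP : IsLowerSet P)
    {x : Fin m → K} (hx : x ∈ degreeSupported K a' P) : dehom φ x ∈ degreeSupported K a P := by
  intro q hq
  rw [dehom_apply]
  refine Finset.sum_eq_zero fun p _ => ?_
  by_cases h : a' p ∈ P
  · have : evalOne (φ (Pi.single p 1) q) = 0 := (hφ p).evalOne_mem q (fun h' => hq (hP h' h))
    rw [this, zero_mul]
  · rw [hx p h, mul_zero]

end FreeModules

/-! ### Homogeneous components and exactness of the dehomogenised strands. -/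

section Strands

variable {V K : Type*} [Fintype V] [Field K]

/-- The exponent vector with the given entries (negative entries are replaced by zero). -/
noncomputable def exponent (c : V → ℤ) : V →₀ ℕ := Finsupp.equivFunOnFinite.symm fun v => (c v).toNat

lemma exponent_apply {c : V → ℤ} (hc : 0 ≤ c) (v : V) : (exponent c v : ℤ) = c v := by
  simpa [exponent] using hc v

lemma exponent_eq {c : V → ℤ} {m : V →₀ ℕ} (h : ∀ v, (m v : ℤ) = c v) : exponent c = m := by
  ext v
  simp [exponent, ← h]

open Classical in
/-- The component of degree `c` of a polynomial. -/
noncomputable def homComponent (c : V → ℤ) : MvPolynomial V K →ₗ[K] MvPolynomial V K :=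
  if 0 ≤ c then (monomial (exponent c)).comp (lcoeff K (exponent c)) else 0

lemma homComponent_of_nonneg {c : V → ℤ} (hc : 0 ≤ c) (f : MvPolynomial V K) :
    homComponent c f = monomial (exponent c) (coeff (exponent c) f) := by
  simp [homComponent, hc]

lemma homComponent_of_not_nonneg {c : V → ℤ} (hc : ¬ 0 ≤ c) (f : MvPolynomial V K) :
    homComponent c f = 0 := by
  simp [homComponent, hc]

lemma isMultihomogeneous_homComponent (c : V → ℤ) (f : MvPolynomial V K) :
    IsMultihomogeneous (homComponent c f) c := by
  by_cases hc : 0 ≤ c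
  · rw [homComponent_of_nonneg hc]
    exact isMultihomogeneous_monomial (exponent_apply hc) _
  · rw [homComponent_of_not_nonneg hc]
    exact .zero _

open Classical in
lemma homComponent_monomial (c : V → ℤ) (m : V →₀ ℕ) (r : K) :
    homComponent c (monomial m r) = if ∀ v, (m v : ℤ) = c v then monomial m r else 0 := by
  by_cases hc : 0 ≤ c
  · rw [homComponent_of_nonneg hc]
    split_ifs with h
    · rw [exponent_eq h]; simp
    · rw [coeff_monomial, if_neg, map_zero]
      rintro rfl
      exact h (exponent_apply hc)
  · rw [homComponent_of_not_nonneg hc, if_neg]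
    intro h
    apply hc
    intro v
    rw [← h]
    exact Int.natCast_nonneg _

lemma IsMultihomogeneous.homComponent_eq {f : MvPolynomial V K} {b : V → ℤ}
    (hf : IsMultihomogeneous f b) : homComponent b f = f := by
  by_cases h0 : f = 0
  · simp [h0]
  obtain ⟨m, r, -, hm, rfl⟩ := hf.eq_monomial h0
  rw [homComponent_monomial, if_pos hm]

lemma homComponent_mul {g : MvPolynomial V K} {e : V → ℤ} (hg : IsMultihomogeneous g e)
    (c : V → ℤ) (f : MvPolynomial V K) :
    homComponent c (f * g) = homComponent (c - e) f * g := by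
  by_cases h0 : g = 0
  · simp [h0]
  obtain ⟨n, q, -, hn, rfl⟩ := hg.eq_monomial h0
  induction f using MvPolynomial.induction_on' with
  | monomial m r =>
    rw [monomial_mul, homComponent_monomial, homComponent_monomial]
    have : (∀ v, ((m + n) v : ℤ) = c v) ↔ ∀ v, (m v : ℤ) = (c - e) v := by
      refine forall_congr' fun v => ?_
      simp only [Finsupp.add_apply, Pi.sub_apply, ← hn]
      push_cast
      omega
    simp only [this]
    split_ifs <;> simp [monomial_mul]
  | add p q hp hq => rw [add_mul, map_add, hp, hq, map_add, add_mul]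

/-- The component of degree `b` of an element of the graded free module with degrees `a`. -/
noncomputable def vecComponent {r : ℕ} (a : Fin r → V → ℤ) (b : V → ℤ)
    (X : Fin r → MvPolynomial V K) : Fin r → MvPolynomial V K :=
  fun q => homComponent (b - a q) (X q)

lemma isHomogeneousElement_vecComponent {r : ℕ} (a : Fin r → V → ℤ) (b : V → ℤ)
    (X : Fin r → MvPolynomial V K) : IsHomogeneousElement a (vecComponent a b X) b :=
  fun _ => isMultihomogeneous_homComponent _ _

lemma IsHomogeneousElement.vecComponent_eq {r : ℕ} {a : Fin r → V → ℤ} {b : V → ℤ}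
    {X : Fin r → MvPolynomial V K} (hX : IsHomogeneousElement a X b) : vecComponent a b X = X :=
  funext fun q => (hX q).homComponent_eq

variable {l m n : ℕ} {c : Fin l → V → ℤ} {a' : Fin m → V → ℤ} {a : Fin n → V → ℤ}
  {ψ : (Fin l → MvPolynomial V K) →ₗ[MvPolynomial V K] (Fin m → MvPolynomial V K)}
  {φ : (Fin m → MvPolynomial V K) →ₗ[MvPolynomial V K] (Fin n → MvPolynomial V K)}

lemma IsGradedMap.vecComponent_map (hφ : IsGradedMap a' a φ) (b : V → ℤ)
    (X : Fin m → MvPolynomial V K) : vecComponent a b (φ X) = φ (vecComponent a' b X) := by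
  funext q
  rw [map_apply_eq_sum, vecComponent, map_apply_eq_sum, map_sum]
  refine Finset.sum_congr rfl fun p _ => ?_
  rw [homComponent_mul (hφ p q), vecComponent]
  rw [sub_sub_sub_cancel_right]

lemma IsGradedMap.isHomogeneousElement (hφ : IsGradedMap a' a φ) {b : V → ℤ}
    {X : Fin m → MvPolynomial V K} (hX : IsHomogeneousElement a' X b) :
    IsHomogeneousElement a (φ X) b := by
  rw [← hX.vecComponent_eq, ← hφ.vecComponent_map]
  exact isHomogeneousElement_vecComponent _ _ _

lemma exists_isHomogeneousElement {b : V → ℤ} {x : Fin n → K}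
    (hx : x ∈ degreeSupported K a (Set.Iic b)) :
    ∃ X : Fin n → MvPolynomial V K, IsHomogeneousElement a X b ∧ (fun q => evalOne (X q)) = x := by
  refine ⟨fun q => monomial (exponent (b - a q)) (x q), fun q => ?_, ?_⟩
  · by_cases h : a q ≤ b
    · exact isMultihomogeneous_monomial (exponent_apply (sub_nonneg.2 h)) _
    · simp only [hx q h, map_zero]
      exact .zero _
  · funext q
    exact evalOne_monomial _ _

/-- Evaluation at ones identifies the degree `b` part of a graded free module with the vectors
supported on basis elements of degree at most `b`. A preimage over the polynomial ring can be
replaced by its component of degree `b`, so exactness passes to each strand. -/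
lemma exists_dehom_eq (hψ : IsGradedMap c a' ψ) (hφ : IsGradedMap a' a φ)
    (h : Function.Exact ψ φ) {b : V → ℤ} {x : Fin m → K}
    (hx : x ∈ degreeSupported K a' (Set.Iic b)) (h0 : dehom φ x = 0) :
    ∃ y ∈ degreeSupported K c (Set.Iic b), dehom ψ y = x := by
  obtain ⟨X, hX, rfl⟩ := exists_isHomogeneousElement hx
  rw [dehom_evalOne] at h0
  have hφX : φ X = 0 := funext fun q =>
    (hφ.isHomogeneousElement hX q).eq_zero (congrFun h0 q)
  obtain ⟨Y, rfl⟩ := (h X).1 hφX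
  refine ⟨_, (isHomogeneousElement_vecComponent c b Y).evalOne_mem, ?_⟩
  rw [dehom_evalOne, ← hψ.vecComponent_map, hX.vecComponent_eq]

end Strands

/-! ### Existence of minimal graded free resolutions. -/

section Existence

variable {V K : Type*} [Fintype V] [Field K]

open Classical in
lemma coeff_homComponent (c : V → ℤ) (f : MvPolynomial V K) (m : V →₀ ℕ) :
    coeff m (homComponent c f) = if c = fun v => (m v : ℤ) then coeff m f else 0 := by
  by_cases hc : 0 ≤ c
  · rw [homComponent_of_nonneg hc, coeff_monomial]
    by_cases h : c = fun v => (m v : ℤ)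
    · have : exponent c = m := exponent_eq fun v => by rw [h]
      rw [if_pos this, if_pos h, this]
    · rw [if_neg h, if_neg]
      rintro rfl
      exact h (funext fun v => (exponent_apply hc v).symm)
  · rw [homComponent_of_not_nonneg hc, if_neg, coeff_zero]
    rintro rfl
    exact hc fun v => Int.natCast_nonneg _

lemma homComponent_zero (f : MvPolynomial V K) : homComponent 0 f = C (constantCoeff f) := by
  rw [homComponent_of_nonneg le_rfl, exponent_eq (m := 0) (by simp)]
  rfl

lemma exists_eq_sum_vecComponent {n : ℕ} (a : Fin n → V → ℤ) (X : Fin n → MvPolynomial V K) :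
    ∃ B : Finset (V → ℤ), X = ∑ b ∈ B, vecComponent a b X := by
  classical
  refine ⟨Finset.univ.biUnion fun q => (X q).support.image fun m => (fun v => (m v : ℤ)) + a q, ?_⟩
  funext q
  ext m
  rw [Finset.sum_apply, coeff_sum]
  simp only [vecComponent, coeff_homComponent, sub_eq_iff_eq_add]
  rw [Finset.sum_ite_eq']
  split_ifs with h
  · rfl
  · by_contra h'
    apply h
    simp only [Finset.mem_biUnion, Finset.mem_image]
    exact ⟨q, Finset.mem_univ _, m, mem_support_iff.2 h', rfl⟩

/-- A submodule of a graded free module that contains the homogeneous components of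
its elements. -/
def IsGradedSubmodule {n : ℕ} (a : Fin n → V → ℤ)
    (N : Submodule (MvPolynomial V K) (Fin n → MvPolynomial V K)) : Prop :=
  ∀ b, ∀ X ∈ N, vecComponent a b X ∈ N

lemma IsGradedMap.isGradedSubmodule_ker {m n : ℕ} {a' : Fin m → V → ℤ} {a : Fin n → V → ℤ}
    {φ : (Fin m → MvPolynomial V K) →ₗ[MvPolynomial V K] (Fin n → MvPolynomial V K)}
    (hφ : IsGradedMap a' a φ) : IsGradedSubmodule a' (LinearMap.ker φ) := by
  intro b X hX
  rw [LinearMap.mem_ker] at hX ⊢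
  rw [← hφ.vecComponent_map, hX]
  funext q
  simp [vecComponent]

/-- There are `r` homogeneous generators of the submodule `N`. -/
def HasHomogeneousGenerators {n : ℕ} (a : Fin n → V → ℤ)
    (N : Submodule (MvPolynomial V K) (Fin n → MvPolynomial V K)) (r : ℕ) : Prop :=
  ∃ (g : Fin r → Fin n → MvPolynomial V K) (a' : Fin r → V → ℤ),
    (∀ p, IsHomogeneousElement a (g p) (a' p)) ∧
      Submodule.span (MvPolynomial V K) (Set.range g) = N

lemma IsGradedSubmodule.exists_hasHomogeneousGenerators {n : ℕ} {a : Fin n → V → ℤ}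
    {N : Submodule (MvPolynomial V K) (Fin n → MvPolynomial V K)} (hN : IsGradedSubmodule a N) :
    ∃ r, HasHomogeneousGenerators a N r := by
  classical
  obtain ⟨G, hG⟩ : N.FG := IsNoetherian.noetherian N
  choose B hB using exists_eq_sum_vecComponent a (K := K)
  let H : Finset (Fin n → MvPolynomial V K) :=
    G.biUnion fun X => (B X).image fun b => vecComponent a b X
  have hH : ∀ Y : H, ∃ b, IsHomogeneousElement a Y.1 b := by
    rintro ⟨Y, hY⟩
    simp only [H, Finset.mem_biUnion, Finset.mem_image] at hY
    obtain ⟨X, -, b, -, rfl⟩ := hY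
    exact ⟨b, isHomogeneousElement_vecComponent a b X⟩
  choose b hb using hH
  refine ⟨H.card, fun p => (H.equivFin.symm p).1, fun p => b (H.equivFin.symm p),
    fun p => hb _, ?_⟩
  have hr : Set.range (fun p => (H.equivFin.symm p).1) = (H : Set (Fin n → MvPolynomial V K)) := by
    ext Y
    constructor
    · rintro ⟨p, rfl⟩
      exact (H.equivFin.symm p).2
    · intro hY
      exact ⟨H.equivFin ⟨Y, hY⟩, by simp⟩
  rw [hr]
  apply le_antisymm
  · rw [Submodule.span_le]
    intro Y hY
    simp only [H, Finset.mem_coe, Finset.mem_biUnion, Finset.mem_image] at hY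
    obtain ⟨X, hX, b, -, rfl⟩ := hY
    exact hN b X (hG ▸ Submodule.subset_span hX)
  · rw [← hG, Submodule.span_le]
    intro X hX
    rw [SetLike.mem_coe, hB X]
    refine Submodule.sum_mem _ fun b hb => Submodule.subset_span ?_
    simp only [H, Finset.mem_coe, Finset.mem_biUnion, Finset.mem_image]
    exact ⟨X, hX, b, hb, rfl⟩

/-- A graded surjection from a graded free module onto a submodule whose kernel is contained
in `𝔪` times the free module. -/
structure MinimalCover {n : ℕ} (a : Fin n → V → ℤ)
    (N : Submodule (MvPolynomial V K) (Fin n → MvPolynomial V K)) where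
  rank : ℕ
  deg : Fin rank → V → ℤ
  map : (Fin rank → MvPolynomial V K) →ₗ[MvPolynomial V K] (Fin n → MvPolynomial V K)
  graded : IsGradedMap deg a map
  range_eq : LinearMap.range map = N
  minimal : ∀ X, map X = 0 → ∀ p, constantCoeff (X p) = 0

/-- A homogeneous generating set of least size works: a relation with a nonzero constant term in
some coefficient would make that generator redundant. -/
lemma IsGradedSubmodule.nonempty_minimalCover {n : ℕ} {a : Fin n → V → ℤ}
    {N : Submodule (MvPolynomial V K) (Fin n → MvPolynomial V K)} (hN : IsGradedSubmodule a N) :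
    Nonempty (MinimalCover a N) := by
  classical
  have hex := hN.exists_hasHomogeneousGenerators
  obtain ⟨r, ⟨g, a', hg, hspan⟩, hmin⟩ :
      ∃ r, HasHomogeneousGenerators a N r ∧ ∀ r' < r, ¬ HasHomogeneousGenerators a N r' :=
    ⟨Nat.find hex, Nat.find_spec hex, fun r' h => Nat.find_min hex h⟩
  have hgr : IsGradedMap a' a (Fintype.linearCombination (MvPolynomial V K) g) := by
    intro p
    simpa [Fintype.linearCombination_apply_single] using hg p
  refine ⟨⟨r, a', _, hgr, by rw [Fintype.range_linearCombination, hspan], ?_⟩⟩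
  intro X hX p
  by_contra hp
  have hker := hgr.isGradedSubmodule_ker (a' p) X hX
  -- The component of the relation in degree `a' p` is again a relation, and its coefficient at `p`
  -- is a nonzero constant, hence invertible.
  set Y := vecComponent a' (a' p) X with hY
  have hYp : Y p = C (constantCoeff (X p)) := by
    rw [hY, vecComponent, sub_self, homComponent_zero]
  rw [LinearMap.mem_ker, Fintype.linearCombination_apply] at hker
  obtain _ | r := r
  · exact p.elim0
  refine hmin r (Nat.lt_succ_self r) ⟨fun i => g (p.succAbove i), fun i => a' (p.succAbove i),
    fun i => hg _, ?_⟩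
  rw [← hspan]
  apply le_antisymm
  · apply Submodule.span_mono
    rintro _ ⟨i, rfl⟩
    exact ⟨_, rfl⟩
  · rw [Submodule.span_le]
    rintro _ ⟨i, rfl⟩
    have hmem : ∀ j, g (p.succAbove j) ∈
        Submodule.span (MvPolynomial V K) (Set.range fun i => g (p.succAbove i)) :=
      fun j => Submodule.subset_span ⟨j, rfl⟩
    obtain rfl | ⟨j, rfl⟩ := Fin.eq_self_or_eq_succAbove p i
    · rw [Fin.sum_univ_succAbove _ i, hYp] at hker
      have e : g i = (C (constantCoeff (X i))⁻¹ : MvPolynomial V K) •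
          -∑ j, Y (i.succAbove j) • g (i.succAbove j) := by
        rw [← eq_neg_of_add_eq_zero_left hker, smul_smul, ← C_mul, inv_mul_cancel₀ hp, C_1, one_smul]
      rw [SetLike.mem_coe, e]
      exact Submodule.smul_mem _ _ (Submodule.neg_mem _
        (Submodule.sum_mem _ fun j _ => Submodule.smul_mem _ _ (hmem j)))
    · exact hmem j

/-- A graded submodule of some graded free module. -/
structure GradedSubmodule (V K : Type*) [Fintype V] [Field K] where
  rank : ℕ
  deg : Fin rank → V → ℤ
  carrier : Submodule (MvPolynomial V K) (Fin rank → MvPolynomial V K)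
  graded : IsGradedSubmodule deg carrier

/-- A choice of a minimal cover. -/
noncomputable def GradedSubmodule.cover (G : GradedSubmodule V K) : MinimalCover G.deg G.carrier :=
  Classical.choice G.graded.nonempty_minimalCover

/-- The first syzygies of a graded submodule. -/
noncomputable def GradedSubmodule.syzygies (G : GradedSubmodule V K) : GradedSubmodule V K where
  rank := G.cover.rank
  deg := G.cover.deg
  carrier := LinearMap.ker G.cover.map
  graded := G.cover.graded.isGradedSubmodule_ker

/-- The iterated syzygies of a graded submodule. -/
noncomputable def GradedSubmodule.iteratedSyzygies (G : GradedSubmodule V K) :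
    ℕ → GradedSubmodule V K
  | 0 => G
  | i + 1 => (G.iteratedSyzygies i).syzygies

/-- Lower bounds on Betti numbers need this: they are infima over resolutions, and the infimum of
the empty set of naturals is 0. -/
theorem nonempty_minimalFreeResolution {J : Ideal (MvPolynomial V K)}
    (hJ : ∀ c, ∀ f ∈ J, homComponent c f ∈ J) : Nonempty (MinimalFreeResolution J) := by
  let G : GradedSubmodule V K :=
    { rank := 1
      deg := fun _ => 0
      carrier := Submodule.comap (LinearMap.proj 0) J
      graded := fun b X hX => hJ _ _ hX }
  have exact_iff : ∀ (G : GradedSubmodule V K) x,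
      G.cover.map x = 0 ↔ x ∈ Set.range G.syzygies.cover.map := by
    intro G x
    exact (SetLike.ext_iff.1 G.syzygies.cover.range_eq x).symm
  have range_aug : LinearMap.range ((LinearMap.proj 0).comp G.cover.map) = J := by
    rw [LinearMap.range_comp, G.cover.range_eq]
    exact Submodule.map_comap_eq_of_surjective (fun f => ⟨fun _ => f, rfl⟩) J
  have exact_zero : ∀ x, G.cover.map x 0 = 0 ↔ x ∈ Set.range G.syzygies.cover.map := by
    intro x
    rw [← exact_iff]
    refine ⟨fun h => funext fun q => ?_, fun h => congrFun h 0⟩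
    rw [Subsingleton.elim q 0]
    exact h
  refine ⟨
    -- The shift by one arises because stage 0 is `J` itself inside a free module of rank one; the
    -- ambient module of stage 1 is the cover of `J`, that is, F_0.
    { rank := fun i => (G.iteratedSyzygies (i + 1)).rank
      deg := fun i => (G.iteratedSyzygies (i + 1)).deg
      aug := (LinearMap.proj 0).comp G.cover.map
      d := fun i => (G.iteratedSyzygies (i + 1)).cover.map
      aug_graded := ?_
      d_graded := fun i => (G.iteratedSyzygies (i + 1)).cover.graded
      range_aug := range_aug
      exact_zero := exact_zero
      exact_succ := fun i => exact_iff (G.iteratedSyzygies (i + 1))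
      minimal := ?_ }⟩
  · intro p
    have := G.cover.graded p 0
    rwa [sub_zero] at this
  · intro i p q
    refine (G.iteratedSyzygies i).cover.minimal _ ?_ q
    exact (exact_iff (G.iteratedSyzygies i) _).2 ⟨Pi.single p 1, rfl⟩

end Existence

/-! ### Mayer–Vietoris criteria for a basis element in a given multidegree. -/

section Nonvanishing

variable {V K : Type*} [Field K] {J : Ideal (MvPolynomial V K)}

/-- The monomial with exponent vector `c` exists and lies in `J`. -/
def HasMonomial (J : Ideal (MvPolynomial V K)) (c : V → ℤ) : Prop :=
  ∃ m : V →₀ ℕ, (∀ v, (m v : ℤ) = c v) ∧ monomial m 1 ∈ J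

lemma HasMonomial.mono [Fintype V] {b c : V → ℤ} (hb : HasMonomial J b) (h : b ≤ c) :
    HasMonomial J c := by
  obtain ⟨m, hm, hJ⟩ := hb
  have hbc : 0 ≤ c - b := sub_nonneg.2 h
  refine ⟨exponent (c - b) + m, fun v => ?_, ?_⟩
  · have := exponent_apply hbc v
    simp only [Finsupp.add_apply, Nat.cast_add, this, hm, Pi.sub_apply]
    ring
  · have := J.mul_mem_left (monomial (exponent (c - b)) 1) hJ
    rwa [monomial_mul, one_mul] at this

/-- The degrees below `b` that are strictly smaller at some vertex of `T`. -/
def belowAt (T : Finset V) (b : V → ℤ) : Set (V → ℤ) :=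
  {c | c ≤ b ∧ ∃ v ∈ T, c v < b v}

lemma isLowerSet_belowAt (T : Finset V) (b : V → ℤ) : IsLowerSet (belowAt T b) := by
  rintro c d h ⟨hc, v, hv, hlt⟩
  exact ⟨h.trans hc, v, hv, (h v).trans_lt hlt⟩

/-- The indicator function of a set of vertices. -/
noncomputable def indicatorDegree (T : Finset V) : V → ℤ := Set.indicator (T : Set V) 1

lemma indicatorDegree_of_mem {T : Finset V} {v : V} (h : v ∈ T) : indicatorDegree T v = 1 := by
  simp [indicatorDegree, h]

lemma indicatorDegree_of_notMem {T : Finset V} {v : V} (h : v ∉ T) : indicatorDegree T v = 0 := by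
  simp [indicatorDegree, h]

lemma indicatorDegree_nonneg (T : Finset V) : 0 ≤ indicatorDegree T := by
  intro v
  by_cases h : v ∈ T <;> simp [indicatorDegree, h]

lemma sub_indicatorDegree_mem_belowAt {T : Finset V} (hT : T.Nonempty) {b c : V → ℤ} (h : c ≤ b) :
    c - indicatorDegree T ∈ belowAt T b := by
  refine ⟨(sub_le_self _ (indicatorDegree_nonneg T)).trans h, ?_⟩
  obtain ⟨v, hv⟩ := hT
  refine ⟨v, hv, ?_⟩
  have : c v ≤ b v := h v
  simp only [Pi.sub_apply, indicatorDegree_of_mem hv]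
  omega

lemma indicatorDegree_cons {T : Finset V} {v : V} (hv : v ∉ T) :
    indicatorDegree (T.cons v hv) = indicatorDegree {v} + indicatorDegree T := by
  funext w
  by_cases h : w = v
  · subst h; simp [indicatorDegree, hv]
  · by_cases h' : w ∈ T <;> simp [indicatorDegree, h, h']

lemma le_sub_indicatorDegree_singleton {b c : V → ℤ} {v : V} :
    c ≤ b - indicatorDegree {v} ↔ c ≤ b ∧ c v < b v := by
  constructor
  · intro h
    refine ⟨h.trans (sub_le_self _ (indicatorDegree_nonneg _)), ?_⟩
    have := h v
    simp only [Pi.sub_apply, indicatorDegree_of_mem (Finset.mem_singleton_self v)] at this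
    omega
  · rintro ⟨h, hv⟩ w
    have := h w
    by_cases hw : w = v
    · subst hw
      simp only [Pi.sub_apply, indicatorDegree_of_mem (Finset.mem_singleton_self w)]
      omega
    · simpa [indicatorDegree, hw] using this

lemma belowAt_singleton (v : V) (b : V → ℤ) :
    belowAt {v} b = Set.Iic (b - indicatorDegree {v}) := by
  ext c
  simp [belowAt, le_sub_indicatorDegree_singleton]

lemma belowAt_cons {T : Finset V} {v : V} (hv : v ∉ T) (b : V → ℤ) :
    belowAt (T.cons v hv) b = belowAt T b ∪ Set.Iic (b - indicatorDegree {v}) := by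
  ext c
  simp only [belowAt, Set.mem_union, Set.mem_ofPred_eq, Set.mem_Iic,
    le_sub_indicatorDegree_singleton, Finset.mem_cons, exists_eq_or_imp]
  rw [← and_or_left, or_comm]

lemma belowAt_inter_Iic {T : Finset V} {v : V} (hv : v ∉ T) (b : V → ℤ) :
    belowAt T b ∩ Set.Iic (b - indicatorDegree {v}) = belowAt T (b - indicatorDegree {v}) := by
  ext c
  have key : ∀ w ∈ T, (b - indicatorDegree {v}) w = b w := by
    intro w hw
    have : w ∉ ({v} : Finset V) := by
      rw [Finset.mem_singleton]; rintro rfl; exact hv hw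
    simp [indicatorDegree_of_notMem this]
  constructor
  · rintro ⟨⟨-, w, hw, hlt⟩, h⟩
    exact ⟨h, w, hw, by rwa [key w hw]⟩
  · rintro ⟨h, w, hw, hlt⟩
    exact ⟨⟨(le_sub_indicatorDegree_singleton.1 h).1, w, hw, by rwa [key w hw] at hlt⟩, h⟩

lemma belowAt_mono_left_cons {T : Finset V} {v : V} (hv : v ∉ T) (b : V → ℤ) :
    belowAt T (b - indicatorDegree {v}) ⊆ belowAt T b := by
  rw [← belowAt_inter_Iic hv]
  exact Set.inter_subset_left

/-- Three vectors with sum zero are the differences of vectors on the pairwise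
intersections of the supports. -/
lemma exists_eq_sub_of_add_eq_zero {r : ℕ} {a : Fin r → V → ℤ} {P₁ P₂ P₃ : Set (V → ℤ)}
    {y₁ y₂ y₃ : Fin r → K} (h₁ : y₁ ∈ degreeSupported K a P₁) (h₂ : y₂ ∈ degreeSupported K a P₂)
    (h₃ : y₃ ∈ degreeSupported K a P₃) (h : y₁ + y₂ + y₃ = 0) :
    ∃ z₁₂ ∈ degreeSupported K a (P₁ ∩ P₂), ∃ z₂₃ ∈ degreeSupported K a (P₂ ∩ P₃),
      ∃ z₃₁ ∈ degreeSupported K a (P₃ ∩ P₁),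
        y₁ = z₁₂ - z₃₁ ∧ y₂ = z₂₃ - z₁₂ ∧ y₃ = z₃₁ - z₂₃ := by
  classical
  have hp : ∀ p, y₁ p + y₂ p + y₃ p = 0 := fun p => congrFun h p
  -- The choice is made one coordinate at a time. Inside `P₂` one may take `z₃₁ = 0`; outside it
  -- `y₂` vanishes, so `y₃ = -y₁` is supported on `P₃ ∩ P₁` and serves as `z₃₁`.
  refine ⟨fun p => if a p ∈ P₂ then y₁ p else 0, ?_, fun p => if a p ∈ P₂ then - y₃ p else 0, ?_,
    fun p => if a p ∈ P₂ then 0 else y₃ p, ?_, ?_, ?_, ?_⟩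
  · intro p hp
    by_cases h : a p ∈ P₂
    · simpa [h] using h₁ p fun h' => hp ⟨h', h⟩
    · simp [h]
  · intro p hp
    by_cases h : a p ∈ P₂
    · simpa [h] using h₃ p fun h' => hp ⟨h, h'⟩
    · simp [h]
  · intro p hp'
    by_cases h : a p ∈ P₂
    · simp [h]
    · have e := hp p
      rw [h₂ p h, add_zero] at e
      simp only [h, if_false]
      by_cases h' : a p ∈ P₁
      · exact h₃ p fun h'' => hp' ⟨h'', h'⟩
      · rwa [h₁ p h', zero_add] at e
  · funext p
    by_cases h : a p ∈ P₂
    · simp [h]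
    · have e := hp p
      rw [h₂ p h, add_zero] at e
      simpa [h] using eq_neg_of_add_eq_zero_left e
  · funext p
    by_cases h : a p ∈ P₂
    · simp only [Pi.sub_apply, h, if_true]
      linear_combination hp p
    · simp [h, h₂ p h]
  · funext p
    by_cases h : a p ∈ P₂ <;> simp [h]

namespace MinimalFreeResolution

variable (F : MinimalFreeResolution J)

/-- The augmentation, as a map to a free module of rank one. -/
noncomputable def augVec : (Fin (F.rank 0) → MvPolynomial V K) →ₗ[MvPolynomial V K]
    (Fin 1 → MvPolynomial V K) := LinearMap.pi fun _ => F.aug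

lemma augVec_graded : IsGradedMap (F.deg 0) (fun _ => 0) F.augVec := by
  intro p q
  simpa [augVec] using F.aug_graded p

lemma exact_augVec : Function.Exact (F.d 0) F.augVec := by
  intro x
  rw [← F.exact_zero x]
  simp [augVec, funext_iff]

lemma aug_d (X) : F.augVec (F.d 0 X) = 0 := (F.exact_augVec _).2 ⟨X, rfl⟩

lemma d_d (i : ℕ) (X) : F.d i (F.d (i + 1) X) = 0 := (F.exact_succ i _).2 ⟨X, rfl⟩

/-- Otherwise the basis vector would be a boundary by exactness, but boundaries have no constant
terms by minimality. -/
lemma d_single_ne_zero (i : ℕ) (p : Fin (F.rank (i + 1))) : F.d i (Pi.single p 1) ≠ 0 := by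
  intro h
  obtain ⟨Y, hY⟩ := (F.exact_succ i _).1 h
  have := congrArg constantCoeff (congrFun hY p)
  rw [map_apply_eq_sum, map_sum] at this
  simp [F.minimal] at this

lemma aug_single_ne_zero (p : Fin (F.rank 0)) : F.aug (Pi.single p 1) ≠ 0 := by
  intro h
  obtain ⟨Y, hY⟩ := (F.exact_zero _).1 h
  have := congrArg constantCoeff (congrFun hY p)
  rw [map_apply_eq_sum, map_sum] at this
  simp [F.minimal] at this

lemma deg_nonneg (i : ℕ) (p : Fin (F.rank i)) : 0 ≤ F.deg i p := by
  induction i with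
  | zero => exact (F.aug_graded p).nonneg (F.aug_single_ne_zero p)
  | succ i ih =>
    obtain ⟨q, hq⟩ := Function.ne_iff.1 (F.d_single_ne_zero i p)
    have := (F.d_graded i p q).nonneg hq
    exact (ih q).trans (sub_nonneg.1 this)

variable {F}

/-- The image of a basis element of F_0 is a nonzero scalar times a monomial of `J`, so F_0 has no
basis element with degree in `P`. -/
lemma dehom_augVec_eq_zero {P : Set (V → ℤ)} (hP : ∀ c ∈ P, ¬ HasMonomial J c)
    {x : Fin (F.rank 0) → K} (hx : x ∈ degreeSupported K (F.deg 0) P) :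
    dehom F.augVec x = 0 := by
  funext q
  rw [dehom_apply]
  refine Finset.sum_eq_zero fun p _ => ?_
  by_cases h : F.deg 0 p ∈ P
  · exfalso
    apply hP _ h
    obtain ⟨m, r, hr, hm, he⟩ := (F.aug_graded p).eq_monomial (F.aug_single_ne_zero p)
    refine ⟨m, hm, ?_⟩
    have hJ : F.aug (Pi.single p 1) ∈ J := by
      have h' := LinearMap.mem_range_self F.aug (Pi.single p 1)
      rwa [F.range_aug] at h'
    have := J.mul_mem_left (C r⁻¹) hJ
    rwa [he, C_mul_monomial, inv_mul_cancel₀ hr] at this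
  · rw [hx p h, mul_zero]

variable [Fintype V]

lemma exists_dehom_augVec_eq_one (F : MinimalFreeResolution J) {b : V → ℤ}
    (h : HasMonomial J b) {P : Set (V → ℤ)} (hP : IsLowerSet P) (hb : b ∈ P) :
    ∃ x ∈ degreeSupported K (F.deg 0) P, dehom F.augVec x = 1 := by
  obtain ⟨m, hm, hJ⟩ := h
  rw [← F.range_aug] at hJ
  obtain ⟨Y, hY⟩ := hJ
  refine ⟨_, degreeSupported_mono (hP.Iic_subset hb)
    (isHomogeneousElement_vecComponent (F.deg 0) b Y).evalOne_mem, ?_⟩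
  rw [dehom_evalOne, ← F.augVec_graded.vecComponent_map]
  funext q
  have : F.augVec Y q = monomial m 1 := hY
  rw [vecComponent, this, (isMultihomogeneous_monomial (by simpa using hm) _).homComponent_eq,
    evalOne_monomial]
  rfl

/-- `belowAt T b` is a union of the principal lower sets below `b - indicatorDegree {v}`, v ∈ T,
whose strands are exact. They are glued one vertex at a time by Mayer–Vietoris; the hypothesis on
`J` makes the augmentation nonzero on each intersection, so no new homology appears at F_0. -/
lemma exists_dehom_eq_of_mem_belowAt (F : MinimalFreeResolution J) {T : Finset V}
    (hT : T.Nonempty) {b : V → ℤ} (hJ : HasMonomial J (b - indicatorDegree T))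
    {x : Fin (F.rank 0) → K} (hx : x ∈ degreeSupported K (F.deg 0) (belowAt T b))
    (h0 : dehom F.augVec x = 0) :
    ∃ y ∈ degreeSupported K (F.deg 1) (belowAt T b), dehom (F.d 0) y = x := by
  induction hT using Finset.Nonempty.cons_induction generalizing b x with
  | singleton v =>
    rw [belowAt_singleton] at hx ⊢
    exact exists_dehom_eq (F.d_graded 0) F.augVec_graded F.exact_augVec hx h0
  | cons v T hv hT ih =>
    rw [indicatorDegree_cons, ← sub_sub] at hJ
    rw [belowAt_cons] at hx ⊢
    -- The summands need not have augmentation zero separately. A multiple of `w`, which lives on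
    -- the intersection and has augmentation 1, is moved from one to the other to correct this.
    obtain ⟨x₁, h₁, x₂, h₂, rfl⟩ := exists_add_of_mem_union hx
    obtain ⟨w, hw, hw1⟩ := F.exists_dehom_augVec_eq_one hJ (isLowerSet_belowAt T _)
      (sub_indicatorDegree_mem_belowAt hT le_rfl)
    rw [map_add] at h0
    set r : K := dehom F.augVec x₁ 0 with hr
    have e₁ : dehom F.augVec x₁ = r • 1 := by
      funext q
      rw [Subsingleton.elim q 0]
      simp [hr]
    have e₂ : dehom F.augVec x₂ = - (r • 1) := by rw [← e₁]; exact eq_neg_of_add_eq_zero_right h0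
    have hw₁ : r • w ∈ degreeSupported K (F.deg 0) (belowAt T b) :=
      Submodule.smul_mem _ _ (degreeSupported_mono (belowAt_mono_left_cons hv b) hw)
    have hw₂ : r • w ∈ degreeSupported K (F.deg 0) (Set.Iic (b - indicatorDegree {v})) :=
      Submodule.smul_mem _ _ (degreeSupported_mono (fun c hc => hc.1) hw)
    have hJ' : HasMonomial J (b - indicatorDegree T) :=
      hJ.mono (sub_le_sub_right (sub_le_self _ (indicatorDegree_nonneg _)) _)
    obtain ⟨y₁, hy₁, hd₁⟩ := ih hJ' (Submodule.sub_mem _ h₁ hw₁)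
      (by rw [map_sub, map_smul, e₁, hw1, sub_self])
    obtain ⟨y₂, hy₂, hd₂⟩ := exists_dehom_eq (F.d_graded 0) F.augVec_graded F.exact_augVec
      (Submodule.add_mem _ h₂ hw₂) (by rw [map_add, map_smul, e₂, hw1, neg_add_cancel])
    refine ⟨y₁ + y₂, Submodule.add_mem _ (degreeSupported_mono Set.subset_union_left hy₁)
      (degreeSupported_mono Set.subset_union_right hy₂), ?_⟩
    rw [map_add, hd₁, hd₂]
    abel

/-- If no basis element has degree `a`, then every basis element of degree at most `a` has
a smaller degree at some vertex of the support of `a`. -/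
lemma exists_lt_of_deg_ne {i : ℕ} {a : V → ℤ} (hne : ∀ p, F.deg i p ≠ a)
    (p : Fin (F.rank i)) (hp : F.deg i p ≤ a) : ∃ v, 0 < a v ∧ F.deg i p v < a v := by
  by_contra! h
  apply hne p
  funext v
  refine le_antisymm (hp v) ?_
  by_cases hv : 0 < a v
  · exact h v hv
  · exact (not_lt.1 hv).trans (F.deg_nonneg i p v)

/-- Each of the two sets supports a vector of augmentation 1. If F_1 had no basis element of degree
`a`, their difference would be a boundary splitting along the two sets, and the corrected vectors
would agree on the intersection, where every augmentation is zero. -/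
theorem exists_deg_one_eq (F : MinimalFreeResolution J) {a : V → ℤ} {T₁ T₂ : Finset V}
    (h₁ : T₁.Nonempty) (h₂ : T₂.Nonempty) (hsupp : ∀ v, 0 < a v → v ∈ T₁ ∨ v ∈ T₂)
    (hJ₁ : HasMonomial J (a - indicatorDegree T₁)) (hJ₂ : HasMonomial J (a - indicatorDegree T₂))
    (hnot : ∀ c ∈ belowAt T₁ a ∩ belowAt T₂ a, ¬ HasMonomial J c) :
    ∃ p, F.deg 1 p = a := by
  by_contra! hne
  obtain ⟨x₁, hx₁, e₁⟩ := F.exists_dehom_augVec_eq_one hJ₁ (isLowerSet_belowAt T₁ a)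
    (sub_indicatorDegree_mem_belowAt h₁ le_rfl)
  obtain ⟨x₂, hx₂, e₂⟩ := F.exists_dehom_augVec_eq_one hJ₂ (isLowerSet_belowAt T₂ a)
    (sub_indicatorDegree_mem_belowAt h₂ le_rfl)
  have sub : ∀ T, belowAt T a ⊆ Set.Iic a := fun T c hc => hc.1
  obtain ⟨y, hy, hd⟩ := exists_dehom_eq (F.d_graded 0) F.augVec_graded F.exact_augVec
    (Submodule.sub_mem _ (degreeSupported_mono (sub T₁) hx₁) (degreeSupported_mono (sub T₂) hx₂))
    (by rw [map_sub, e₁, e₂, sub_self])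
  have hy' : y ∈ degreeSupported K (F.deg 1) (belowAt T₁ a ∪ belowAt T₂ a) := by
    intro p hp
    refine hy p fun hle => hp ?_
    obtain ⟨v, hv, hlt⟩ := exists_lt_of_deg_ne hne p hle
    exact (hsupp v hv).imp (fun h => ⟨hle, v, h, hlt⟩) (fun h => ⟨hle, v, h, hlt⟩)
  obtain ⟨y₁, hy₁, y₂, hy₂, rfl⟩ := exists_add_of_mem_union hy'
  rw [map_add] at hd
  have heq : x₁ - dehom (F.d 0) y₁ = x₂ + dehom (F.d 0) y₂ := by
    linear_combination (exp := 1) -hd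
  have m₁ := Submodule.sub_mem _ hx₁
    (IsGradedMap.dehom_mem (F.d_graded 0) (isLowerSet_belowAt T₁ a) hy₁)
  have m₂ := Submodule.add_mem _ hx₂
    (IsGradedMap.dehom_mem (F.d_graded 0) (isLowerSet_belowAt T₂ a) hy₂)
  rw [← heq] at m₂
  have := dehom_augVec_eq_zero hnot (mem_degreeSupported_inter m₁ m₂)
  rw [map_sub, e₁, dehom_dehom F.aug_d, sub_zero] at this
  exact one_ne_zero this

/-- The pairwise intersections support vectors `x`, `y`, `z` of augmentation 1, the vertices of a
triangle. Its sides `u₁`, `u₂`, `u₃` exist within the three sets by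
`exists_dehom_eq_of_mem_belowAt`, and their sum is a cycle. Without a basis element of degree `a` in
F_2, a filling of this cycle would split along the three sets, which pushes `x` by a boundary into
the triple intersection. -/
theorem exists_deg_two_eq (F : MinimalFreeResolution J) {a : V → ℤ} {T₁ T₂ T₃ : Finset V}
    (h₁ : T₁.Nonempty) (h₂ : T₂.Nonempty) (h₃ : T₃.Nonempty)
    (hsupp : ∀ v, 0 < a v → v ∈ T₁ ∨ v ∈ T₂ ∨ v ∈ T₃)
    (hJ₁₂ : HasMonomial J (a - indicatorDegree T₁ - indicatorDegree T₂))
    (hJ₂₃ : HasMonomial J (a - indicatorDegree T₂ - indicatorDegree T₃))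
    (hJ₃₁ : HasMonomial J (a - indicatorDegree T₃ - indicatorDegree T₁))
    (hnot : ∀ c ∈ belowAt T₁ a ∩ (belowAt T₂ a ∩ belowAt T₃ a), ¬ HasMonomial J c) :
    ∃ p, F.deg 2 p = a := by
  by_contra! hne
  have low := fun T : Finset V => isLowerSet_belowAt T a
  have key : ∀ {S T : Finset V}, S.Nonempty → T.Nonempty →
      HasMonomial J (a - indicatorDegree S - indicatorDegree T) →
      ∃ x, x ∈ degreeSupported K (F.deg 0) (belowAt S a) ∧
        x ∈ degreeSupported K (F.deg 0) (belowAt T a) ∧ dehom F.augVec x = 1 := by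
    intro S T hS hT hJ
    obtain ⟨x, hx, e⟩ := F.exists_dehom_augVec_eq_one hJ ((low S).inter (low T))
      ⟨(low S) (sub_le_self _ (indicatorDegree_nonneg T))
        (sub_indicatorDegree_mem_belowAt hS le_rfl),
        sub_indicatorDegree_mem_belowAt hT (sub_le_self _ (indicatorDegree_nonneg S))⟩
    exact ⟨x, degreeSupported_mono Set.inter_subset_left hx,
      degreeSupported_mono Set.inter_subset_right hx, e⟩
  obtain ⟨x, hx₁, hx₂, ex⟩ := key h₁ h₂ hJ₁₂
  obtain ⟨y, hy₂, hy₃, ey⟩ := key h₂ h₃ hJ₂₃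
  obtain ⟨z, hz₃, hz₁, ez⟩ := key h₃ h₁ hJ₃₁
  have mono : ∀ S T, HasMonomial J (a - indicatorDegree S - indicatorDegree T) →
      HasMonomial J (a - indicatorDegree S) :=
    fun S T h => h.mono (sub_le_self _ (indicatorDegree_nonneg T))
  obtain ⟨u₁, hu₁, d₁⟩ := F.exists_dehom_eq_of_mem_belowAt h₁ (mono _ _ hJ₁₂)
    (Submodule.sub_mem _ hx₁ hz₁) (by rw [map_sub, ex, ez, sub_self])
  obtain ⟨u₂, hu₂, d₂⟩ := F.exists_dehom_eq_of_mem_belowAt h₂ (mono _ _ hJ₂₃)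
    (Submodule.sub_mem _ hy₂ hx₂) (by rw [map_sub, ex, ey, sub_self])
  obtain ⟨u₃, hu₃, d₃⟩ := F.exists_dehom_eq_of_mem_belowAt h₃ (mono _ _ hJ₃₁)
    (Submodule.sub_mem _ hz₃ hy₃) (by rw [map_sub, ez, ey, sub_self])
  have sub : ∀ T, degreeSupported K (F.deg 1) (belowAt T a) ≤
      degreeSupported K (F.deg 1) (Set.Iic a) :=
    fun T => degreeSupported_mono fun c hc => hc.1
  obtain ⟨w, hw, dw⟩ := exists_dehom_eq (F.d_graded 1) (F.d_graded 0) (F.exact_succ 0)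
    (Submodule.add_mem _ (Submodule.add_mem _ (sub _ hu₁) (sub _ hu₂)) (sub _ hu₃))
    (by rw [map_add, map_add, d₁, d₂, d₃]; abel)
  have hw' : w ∈ degreeSupported K (F.deg 2) (belowAt T₁ a ∪ (belowAt T₂ a ∪ belowAt T₃ a)) := by
    intro p hp
    refine hw p fun hle => hp ?_
    obtain ⟨v, hv, hlt⟩ := exists_lt_of_deg_ne hne p hle
    exact (hsupp v hv).imp (fun h => ⟨hle, v, h, hlt⟩)
      (Or.imp (fun h => ⟨hle, v, h, hlt⟩) (fun h => ⟨hle, v, h, hlt⟩))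
  obtain ⟨w₁, hw₁, w₀, hw₀, rfl⟩ := exists_add_of_mem_union hw'
  obtain ⟨w₂, hw₂, w₃, hw₃, rfl⟩ := exists_add_of_mem_union hw₀
  have dmem := fun (T : Finset V) {w} (hw : w ∈ degreeSupported K (F.deg 2) (belowAt T a)) =>
    IsGradedMap.dehom_mem (F.d_graded 1) (low T) hw
  obtain ⟨v₁₂, m₁₂, v₂₃, m₂₃, v₃₁, m₃₁, e₁, e₂, e₃⟩ := exists_eq_sub_of_add_eq_zero
    (Submodule.sub_mem _ hu₁ (dmem _ hw₁)) (Submodule.sub_mem _ hu₂ (dmem _ hw₂))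
    (Submodule.sub_mem _ hu₃ (dmem _ hw₃)) (by
      rw [map_add, map_add] at dw
      linear_combination (exp := 1) -dw)
  have dd : ∀ w, dehom (F.d 0) (dehom (F.d 1) w) = 0 := dehom_dehom (F.d_d 0)
  -- The three corrected vertices coincide, so their common value is supported on all three sets
  -- while its augmentation is still 1.
  have f₁ : x - dehom (F.d 0) v₁₂ = z - dehom (F.d 0) v₃₁ := by
    have := congrArg (dehom (F.d 0)) e₁
    rw [map_sub, map_sub, dd, d₁, sub_zero] at this
    linear_combination (exp := 1) this
  have f₂ : x - dehom (F.d 0) v₁₂ = y - dehom (F.d 0) v₂₃ := by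
    have := congrArg (dehom (F.d 0)) e₂
    rw [map_sub, map_sub, dd, d₂, sub_zero] at this
    linear_combination (exp := 1) -this
  have emem := fun (T : Finset V) {w} (hw : w ∈ degreeSupported K (F.deg 1) (belowAt T a)) =>
    IsGradedMap.dehom_mem (F.d_graded 0) (low T) hw
  have n₁ := Submodule.sub_mem _ hx₁ (emem _ (degreeSupported_mono Set.inter_subset_left m₁₂))
  have n₂ := Submodule.sub_mem _ hx₂ (emem _ (degreeSupported_mono Set.inter_subset_right m₁₂))
  have n₃ := Submodule.sub_mem _ hy₃ (emem _ (degreeSupported_mono Set.inter_subset_right m₂₃))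
  rw [← f₂] at n₃
  have := dehom_augVec_eq_zero hnot
    (mem_degreeSupported_inter n₁ (mem_degreeSupported_inter n₂ n₃))
  rw [map_sub, ex, dehom_dehom F.aug_d, sub_zero] at this
  exact one_ne_zero this

end MinimalFreeResolution

end Nonvanishing

/-! ### From basis elements in every resolution to lower bounds on Betti numbers. -/

section BettiNumbers

variable {V K : Type*} [Field K] {J : Ideal (MvPolynomial V K)}

lemma one_le_multigradedBetti (F₀ : MinimalFreeResolution J) {i : ℕ} {a : V → ℤ}
    (h : ∀ F : MinimalFreeResolution J, ∃ p, F.deg i p = a) : 1 ≤ multigradedBetti J i a := by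
  have hne : {n | ∃ F : MinimalFreeResolution J, n = Set.ncard {p | F.deg i p = a}}.Nonempty :=
    ⟨_, F₀, rfl⟩
  obtain ⟨F, hF⟩ := Nat.sInf_mem hne
  rw [multigradedBetti, hF, Nat.one_le_iff_ne_zero, ← Nat.pos_iff_ne_zero,
    Set.ncard_pos (Set.toFinite _)]
  exact h F

lemma multigradedBetti_eq_zero (F : MinimalFreeResolution J) {i : ℕ} {a : V → ℤ}
    (h : ∀ p, F.deg i p ≠ a) : multigradedBetti J i a = 0 := by
  have : (0 : ℕ) ∈ {n | ∃ F : MinimalFreeResolution J, n = Set.ncard {p | F.deg i p = a}} := by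
    refine ⟨F, ?_⟩
    have : {p | F.deg i p = a} = ∅ := Set.eq_empty_of_forall_notMem h
    rw [this, Set.ncard_empty]
  exact Nat.le_zero.1 (Nat.sInf_le this)

variable [Fintype V]

/-- The number of degrees of total degree `j` at which every minimal resolution has a basis
element is a lower bound for the graded Betti number. -/
theorem card_le_gradedBetti (F₀ : MinimalFreeResolution J) {i : ℕ} {j : ℤ}
    (A : Finset (V → ℤ)) (hA : ∀ a ∈ A, ∑ v, a v = j)
    (h : ∀ a ∈ A, ∀ F : MinimalFreeResolution J, ∃ p, F.deg i p = a) :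
    A.card ≤ gradedBetti J i j := by
  classical
  -- A `finsum` with infinite support would be 0. One fixed resolution bounds the support by its
  -- finitely many degrees.
  have hsub : (Function.support fun a : V → ℤ =>
      ∑ᶠ (_ : ∑ v, a v = j), multigradedBetti J i a) ⊆
      ((A ∪ Finset.univ.image (F₀.deg i) : Finset (V → ℤ)) : Set (V → ℤ)) := by
    intro a ha
    rw [Finset.coe_union]
    right
    by_contra hn
    apply ha
    have : multigradedBetti J i a = 0 :=
      multigradedBetti_eq_zero F₀ fun p hp => hn (by simp [← hp])
    simp [this]
  rw [gradedBetti, finsum_eq_sum_of_support_subset _ hsub, Finset.card_eq_sum_ones]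
  refine le_trans ?_ (Finset.sum_le_sum_of_subset Finset.subset_union_left)
  refine Finset.sum_le_sum fun a ha => ?_
  rw [finsum_eq_if, if_pos (hA a ha)]
  exact one_le_multigradedBetti F₀ (h a ha)

lemma sum_indicatorDegree (e : Finset V) : ∑ v, indicatorDegree e v = e.card := by
  classical
  simp [indicatorDegree, Set.indicator_apply]

end BettiNumbers

end MonomialResolution

namespace Clutter

open MvPolynomial MonomialResolution

/-! ### Monomials in powers of the edge ideal as multisets of edges. -/

section PowersOfEdgeIdeals

variable {V K : Type*} [Field K] {C : Clutter V}

/-- The exponent vector of the monomial of an edge. -/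
noncomputable def edgeExponent (e : Finset V) : V →₀ ℕ := ∑ v ∈ e, Finsupp.single v 1

/-- The sums of `s` exponent vectors of edges. -/
def edgeSums (C : Clutter V) (s : ℕ) : Set (V →₀ ℕ) :=
  {m | ∃ A : Multiset (Finset V), A.card = s ∧ (∀ e ∈ A, e ∈ C.edges) ∧
    m = (A.map edgeExponent).sum}

lemma edgeIdeal_pow (C : Clutter V) (s : ℕ) :
    C.edgeIdeal K ^ s = Ideal.span ((fun m => monomial m (1 : K)) '' C.edgeSums s) := by
  induction s with
  | zero =>
    rw [pow_zero, eq_comm, Ideal.one_eq_top, Ideal.eq_top_iff_one]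
    exact Ideal.subset_span ⟨0, ⟨0, by simp⟩, rfl⟩
  | succ s ih =>
    rw [pow_succ, ih, edgeIdeal, Ideal.span_mul_span']
    congr 1
    ext f
    simp only [Set.mem_mul, Set.mem_image]
    constructor
    · rintro ⟨_, ⟨_, ⟨A, rfl, hA, rfl⟩, rfl⟩, _, ⟨e, he, rfl⟩, rfl⟩
      refine ⟨_, ⟨e ::ₘ A, by simp, by simpa [he] using hA, rfl⟩, ?_⟩
      rw [Multiset.map_cons, Multiset.sum_cons, add_comm, ← one_mul (1 : K), ← monomial_mul, one_mul,
        edgeExponent, monomial_sum_one]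
      rfl
    · rintro ⟨_, ⟨A, hA, hAC, rfl⟩, rfl⟩
      obtain ⟨e, he⟩ := Multiset.card_pos_iff_exists_mem.1 (show 0 < A.card by omega)
      obtain ⟨B, rfl⟩ := Multiset.exists_cons_of_mem he
      refine ⟨_, ⟨_, ⟨B, by simpa using hA, fun f hf => hAC f (by simp [hf]), rfl⟩, rfl⟩, _,
        ⟨e, hAC e (by simp), rfl⟩, ?_⟩
      rw [Multiset.map_cons, Multiset.sum_cons, add_comm, ← one_mul (1 : K), ← monomial_mul, one_mul,
        edgeExponent, monomial_sum_one]
      rfl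

lemma homComponent_mem_edgeIdeal_pow [Fintype V] (C : Clutter V) (s : ℕ) (c : V → ℤ)
    (f : MvPolynomial V K) (hf : f ∈ C.edgeIdeal K ^ s) :
    homComponent c f ∈ C.edgeIdeal K ^ s := by
  classical
  rw [edgeIdeal_pow, mem_ideal_span_monomial_image] at hf ⊢
  intro m hm
  refine hf m (mem_support_iff.2 fun h => mem_support_iff.1 hm ?_)
  rw [coeff_homComponent, h, ite_self]

open Classical in
lemma sum_map_edgeExponent_apply (A : Multiset (Finset V)) (v : V) :
    ((A.map edgeExponent).sum v : ℤ) = (A.map fun e => indicatorDegree e v).sum := by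
  induction A using Multiset.induction_on with
  | empty => simp
  | cons e A ih =>
    have : (edgeExponent e v : ℤ) = indicatorDegree e v := by
      simp [edgeExponent, indicatorDegree, Finsupp.finsetSum_apply, Finsupp.single_apply,
        Set.indicator_apply]
    simp [ih, this]

open Classical in
lemma count_le_sum_indicatorDegree {A : Multiset (Finset V)} {e : Finset V} {v : V} (hv : v ∈ e) :
    (A.count e : ℤ) ≤ (A.map fun e => indicatorDegree e v).sum := by
  induction A using Multiset.induction_on with
  | empty => simp
  | cons f A ih =>
    rw [Multiset.map_cons, Multiset.sum_cons, Multiset.count_cons]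
    split_ifs with h
    · rw [← h, indicatorDegree_of_mem hv]
      push_cast
      omega
    · have : 0 ≤ indicatorDegree f v := indicatorDegree_nonneg f v
      push_cast
      omega

lemma hasMonomial_of_multiset {s : ℕ} {A : Multiset (Finset V)} (hs : A.card = s)
    (hA : ∀ e ∈ A, e ∈ C.edges) :
    HasMonomial (C.edgeIdeal K ^ s) (fun v => (A.map fun e => indicatorDegree e v).sum) := by
  refine ⟨(A.map edgeExponent).sum, sum_map_edgeExponent_apply A, ?_⟩
  rw [edgeIdeal_pow]
  exact Ideal.subset_span ⟨_, ⟨A, hs, hA, rfl⟩, rfl⟩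

lemma exists_multiset_of_hasMonomial {s : ℕ} {c : V → ℤ}
    (h : HasMonomial (C.edgeIdeal K ^ s) c) :
    ∃ A : Multiset (Finset V), A.card = s ∧ (∀ e ∈ A, e ∈ C.edges) ∧
      ∀ v, (A.map fun e => indicatorDegree e v).sum ≤ c v := by
  classical
  obtain ⟨m, hm, hJ⟩ := h
  rw [edgeIdeal_pow, mem_ideal_span_monomial_image] at hJ
  obtain ⟨_, ⟨A, hs, hA, rfl⟩, hle⟩ := hJ m (by simp [mem_support_iff])
  refine ⟨A, hs, hA, fun v => ?_⟩
  rw [← sum_map_edgeExponent_apply, ← hm]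
  exact_mod_cast hle v

/-- These are the monomials left when all but one of the factors x_e, x_f (f ∈ P) are divided out of
x_e^s ∏ x_f once. -/
lemma hasMonomial_sub_one_smul_add {s : ℕ} (hs : 1 ≤ s) {e f : Finset V} (he : e ∈ C.edges)
    (hf : f ∈ C.edges) :
    HasMonomial (C.edgeIdeal K ^ s) (((s : ℤ) - 1) • indicatorDegree e + indicatorDegree f) := by
  have := hasMonomial_of_multiset (K := K) (C := C) (s := s)
    (A := f ::ₘ Multiset.replicate (s - 1) e) (by simp; omega) (by
      intro g hg
      rcases Multiset.mem_cons.1 hg with rfl | hg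
      · exact hf
      · rwa [Multiset.eq_of_mem_replicate hg])
  convert this using 1
  funext v
  simp [Nat.cast_sub hs, add_comm]

end PowersOfEdgeIdeals

/-! ### The multidegrees attached to an induced matching and their count. -/

section InducedMatchings

variable {V K : Type*} [Field K] {C : Clutter V} {M : Finset (Finset V)}

/-- The degree of the monomial `x_e ^ s * ∏ f ∈ P, x_f`. -/
noncomputable def matchingDegree (s : ℕ) (e : Finset V) (P : Finset (Finset V)) : V → ℤ :=
  (s : ℤ) • indicatorDegree e + ∑ f ∈ P, indicatorDegree f

lemma IsInducedMatching.matchingDegree_of_mem (hM : C.IsInducedMatching M) {s : ℕ}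
    {e : Finset V} {P : Finset (Finset V)} (he : e ∈ M) (hP : P ⊆ M) (heP : e ∉ P)
    {v : V} (hv : v ∈ e) : matchingDegree s e P v = s := by
  have : ∑ f ∈ P, indicatorDegree f v = 0 := by
    refine Finset.sum_eq_zero fun f hf => indicatorDegree_of_notMem fun hvf => ?_
    exact Finset.disjoint_left.1 (hM.2.1 e he f (hP hf) fun h => heP (h ▸ hf)) hv hvf
  simp [matchingDegree, this, indicatorDegree_of_mem hv]

lemma IsInducedMatching.matchingDegree_of_mem_of_mem (hM : C.IsInducedMatching M) {s : ℕ}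
    {e : Finset V} {P : Finset (Finset V)} (he : e ∈ M) (hP : P ⊆ M) (heP : e ∉ P)
    {f : Finset V} (hf : f ∈ P) {v : V} (hv : v ∈ f) : matchingDegree s e P v = 1 := by
  have h1 : ∑ g ∈ P, indicatorDegree g v = 1 := by
    rw [Finset.sum_eq_single_of_mem f hf, indicatorDegree_of_mem hv]
    intro g hg hgf
    exact indicatorDegree_of_notMem fun hvg =>
      Finset.disjoint_left.1 (hM.2.1 g (hP hg) f (hP hf) hgf) hvg hv
  have h2 : indicatorDegree e v = 0 := indicatorDegree_of_notMem fun hve =>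
    Finset.disjoint_left.1 (hM.2.1 e he f (hP hf) fun h => heP (h ▸ hf)) hve hv
  simp [matchingDegree, h1, h2]

lemma exists_mem_of_matchingDegree_pos {s : ℕ} {e : Finset V} {P : Finset (Finset V)} {v : V}
    (h : 0 < matchingDegree s e P v) : v ∈ e ∨ ∃ f ∈ P, v ∈ f := by
  by_contra! hn
  have : ∑ f ∈ P, indicatorDegree f v = 0 :=
    Finset.sum_eq_zero fun f hf => indicatorDegree_of_notMem (hn.2 f hf)
  simp [matchingDegree, this, indicatorDegree_of_notMem hn.1] at h

/-- A product of s edges dividing such a monomial uses only edges inside the union of `insert e P`,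
and these lie in `insert e P` because the matching is induced and its edges are disjoint. A vertex
of f ∈ P with exponent below 1 excludes f, so the product is x_e^s, which a vertex of e with
exponent below s excludes. -/
lemma IsInducedMatching.not_hasMonomial (hM : C.IsInducedMatching M)
    (hne : ∀ e ∈ M, e.Nonempty) {s : ℕ}
    {e : Finset V} {P : Finset (Finset V)} (he : e ∈ M) (hP : P ⊆ M) (heP : e ∉ P)
    {c : V → ℤ} (hce : c ∈ belowAt e (matchingDegree s e P))
    (hcP : ∀ f ∈ P, c ∈ belowAt f (matchingDegree s e P)) :
    ¬ HasMonomial (C.edgeIdeal K ^ s) c := by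
  classical
  intro h
  obtain ⟨A, hcard, hAC, hle⟩ := exists_multiset_of_hasMonomial h
  have hmem : ∀ g ∈ A, ∀ v ∈ g, v ∈ e ∨ ∃ f ∈ P, v ∈ f := by
    intro g hg v hv
    apply exists_mem_of_matchingDegree_pos (s := s)
    have h1 : 1 ≤ A.count g := Multiset.one_le_count_iff_mem.2 hg
    have h2 := count_le_sum_indicatorDegree (A := A) hv
    have h3 := hle v
    have h4 : c v ≤ matchingDegree s e P v := hce.1 v
    omega
  have hAM : ∀ g ∈ A, g ∈ M := by
    intro g hg
    refine hM.2.2 g (hAC g hg) fun v hv => ?_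
    simp only [Set.mem_iUnion]
    rcases hmem g hg v hv with h | ⟨f, hf, h⟩
    · exact ⟨e, he, h⟩
    · exact ⟨f, hP hf, h⟩
  have hAN : ∀ g ∈ A, g ∈ insert e P := by
    intro g hg
    obtain ⟨v, hv⟩ := hne g (hAM g hg)
    have uniq : ∀ f ∈ M, v ∈ f → g = f := by
      intro f hf hvf
      by_contra hgf
      exact Finset.disjoint_left.1 (hM.2.1 g (hAM g hg) f hf hgf) hv hvf
    rcases hmem g hg v hv with h | ⟨f, hf, h⟩
    · rw [uniq e he h]; exact Finset.mem_insert_self _ _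
    · rw [uniq f (hP hf) h]; exact Finset.mem_insert_of_mem hf
  have hsum := Multiset.sum_count_eq_card hAN
  have hP0 : ∑ f ∈ P, A.count f = 0 := by
    refine Finset.sum_eq_zero fun f hf => ?_
    obtain ⟨-, v, hv, hlt⟩ := hcP f hf
    rw [hM.matchingDegree_of_mem_of_mem he hP heP hf hv] at hlt
    have h2 := count_le_sum_indicatorDegree (A := A) hv
    have h3 := hle v
    omega
  rw [Finset.sum_insert heP, hP0] at hsum
  obtain ⟨-, v, hv, hlt⟩ := hce
  rw [hM.matchingDegree_of_mem he hP heP hv] at hlt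
  have h2 := count_le_sum_indicatorDegree (A := A) hv
  have h3 := hle v
  omega

lemma exists_isInducedMatching_card_eq (h : C.inducedMatchingNumber ≠ 0) :
    ∃ M, C.IsInducedMatching M ∧ M.card = C.inducedMatchingNumber := by
  have hne : {n | ∃ M, C.IsInducedMatching M ∧ M.card = n}.Nonempty := by
    by_contra hn
    rw [Set.not_nonempty_iff_eq_empty] at hn
    exact h (by rw [inducedMatchingNumber, hn, csSup_empty]; rfl)
  refine Nat.sSup_mem hne ⟨C.edges.card, ?_⟩
  rintro _ ⟨M, hM, rfl⟩
  exact Finset.card_le_card hM.1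

/-- An empty edge would be contained in a second edge, against the antichain condition. -/
lemma IsInducedMatching.nonempty_of_one_lt_card (hM : C.IsInducedMatching M) (h : 1 < M.card) :
    ∀ e ∈ M, e.Nonempty := by
  intro e he
  obtain ⟨f, hf, hfe⟩ := Finset.exists_mem_ne h e
  rw [Finset.nonempty_iff_ne_empty]
  rintro rfl
  exact C.antichain (hM.1 he) (hM.1 hf) hfe.symm (Finset.empty_subset f)

/-- On the vertices of an edge of `M` the degree is constantly s, 1 or 0, according to whether the
edge is e, lies in P, or neither. These values differ as s ≥ 2, and nonempty edges have a vertex at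
which to read them. -/
lemma IsInducedMatching.matchingDegree_injOn (hM : C.IsInducedMatching M)
    (hne : ∀ e ∈ M, e.Nonempty) {s : ℕ} (hs : 2 ≤ s) {e e' : Finset V}
    {P P' : Finset (Finset V)} (he : e ∈ M) (hP : P ⊆ M) (heP : e ∉ P) (he' : e' ∈ M)
    (hP' : P' ⊆ M) (heP' : e' ∉ P') (h : matchingDegree s e P = matchingDegree s e' P') :
    e = e' ∧ P = P' := by
  have val : ∀ {e P}, e ∈ M → P ⊆ M → e ∉ P → ∀ f ∈ M, ∀ v ∈ f,
      (matchingDegree s e P v = s ↔ f = e) ∧ (matchingDegree s e P v = 1 ↔ f ∈ P) := by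
    intro e P he hP heP f hf v hv
    by_cases hfe : f = e
    · subst hfe
      rw [hM.matchingDegree_of_mem he hP heP hv]
      exact ⟨iff_of_true rfl rfl, iff_of_false (by omega) heP⟩
    by_cases hfP : f ∈ P
    · rw [hM.matchingDegree_of_mem_of_mem he hP heP hfP hv]
      exact ⟨iff_of_false (by omega) hfe, iff_of_true rfl hfP⟩
    · have h0 : ¬ 0 < matchingDegree s e P v := by
        intro hpos
        rcases exists_mem_of_matchingDegree_pos hpos with h | ⟨g, hg, h⟩
        · exact Finset.disjoint_left.1 (hM.2.1 f hf e he hfe) hv h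
        · exact Finset.disjoint_left.1
            (hM.2.1 f hf g (hP hg) fun hh => hfP (hh ▸ hg)) hv h
      exact ⟨iff_of_false (by omega) hfe, iff_of_false (by omega) hfP⟩
  constructor
  · obtain ⟨v, hv⟩ := hne e he
    exact (val he' hP' heP' e he v hv).1.1 (h ▸ (val he hP heP e he v hv).1.2 rfl)
  · ext f
    constructor
    · intro hf
      obtain ⟨v, hv⟩ := hne f (hP hf)
      exact (val he' hP' heP' f (hP hf) v hv).2.1
        (h ▸ (val he hP heP f (hP hf) v hv).2.2 hf)
    · intro hf
      obtain ⟨v, hv⟩ := hne f (hP' hf)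
      exact (val he hP heP f (hP' hf) v hv).2.1
        (h ▸ (val he' hP' heP' f (hP' hf) v hv).2.2 hf)

variable [Fintype V]

lemma sum_matchingDegree {k s r : ℕ} (hk : C.IsUniform k) {e : Finset V}
    {P : Finset (Finset V)} (he : e ∈ C.edges) (hP : P ⊆ C.edges) (hr : P.card = r) :
    ∑ v, matchingDegree s e P v = (k : ℤ) * s + r * k := by
  have : ∑ f ∈ P, (f.card : ℤ) = r * k := by
    rw [Finset.sum_congr rfl fun f hf => by rw [hk f (hP hf)]]
    simp [hr]
  simp only [matchingDegree, Pi.add_apply, Pi.smul_apply, Finset.sum_apply, smul_eq_mul]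
  rw [Finset.sum_add_distrib, ← Finset.mul_sum, Finset.sum_comm]
  simp only [sum_indicatorDegree, this, hk e he]
  ring

theorem IsInducedMatching.mul_choose_le_gradedBetti (hM : C.IsInducedMatching M)
    (hne : ∀ e ∈ M, e.Nonempty) {k s r : ℕ} (hk : C.IsUniform k) (hs : 2 ≤ s)
    (h : ∀ e ∈ M, ∀ P ⊆ M, e ∉ P → P.card = r →
      ∀ F : MinimalFreeResolution (C.edgeIdeal K ^ s), ∃ p, F.deg r p = matchingDegree s e P) :
    (r + 1) * M.card.choose (r + 1) ≤
      gradedBetti (C.edgeIdeal K ^ s) r ((k : ℤ) * s + r * k) := by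
  classical
  obtain ⟨F₀⟩ := nonempty_minimalFreeResolution (homComponent_mem_edgeIdeal_pow (K := K) C s)
  -- The pairs are ordered: the edge carrying the exponent s is distinguished, which produces the
  -- factor `r + 1` in front of the binomial coefficient.
  let X : Finset (Σ _ : Finset V, Finset (Finset V)) :=
    M.sigma fun e => (M.erase e).powersetCard r
  have hX : ∀ x ∈ X, x.1 ∈ M ∧ x.2 ⊆ M ∧ x.1 ∉ x.2 ∧ x.2.card = r := by
    intro x hx
    simp only [X, Finset.mem_sigma, Finset.mem_powersetCard, Finset.subset_erase] at hx
    tauto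
  have hcard : X.card = (r + 1) * M.card.choose (r + 1) := by
    rw [Finset.card_sigma, Finset.sum_congr rfl fun e he => by
      rw [Finset.card_powersetCard, Finset.card_erase_of_mem he], Finset.sum_const, smul_eq_mul]
    obtain h0 | ⟨n, hn⟩ : M.card = 0 ∨ ∃ n, M.card = n + 1 := by
      cases M.card <;> simp
    · simp [h0]
    · rw [hn, Nat.add_sub_cancel, Nat.add_one_mul_choose_eq, mul_comm]
  have hinj : Set.InjOn (fun x : Σ _ : Finset V, Finset (Finset V) => matchingDegree s x.1 x.2)
      X := by
    rintro ⟨e, P⟩ hx ⟨e', P'⟩ hx' heq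
    obtain ⟨h1, h2, h3, -⟩ := hX _ hx
    obtain ⟨h1', h2', h3', -⟩ := hX _ hx'
    obtain ⟨rfl, rfl⟩ := hM.matchingDegree_injOn hne hs h1 h2 h3 h1' h2' h3' heq
    rfl
  rw [← hcard, ← Finset.card_image_of_injOn hinj]
  refine card_le_gradedBetti F₀ _ ?_ ?_
  · intro a ha
    obtain ⟨x, hx, rfl⟩ := Finset.mem_image.1 ha
    obtain ⟨h1, h2, -, h4⟩ := hX x hx
    exact sum_matchingDegree hk (hM.1 h1) (h2.trans hM.1) h4
  · intro a ha
    obtain ⟨x, hx, rfl⟩ := Finset.mem_image.1 ha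
    obtain ⟨h1, h2, h3, h4⟩ := hX x hx
    exact h _ h1 _ h2 h3 h4

lemma IsInducedMatching.exists_deg_one_eq (hM : C.IsInducedMatching M)
    (hne : ∀ e ∈ M, e.Nonempty) {s : ℕ} (hs : 1 ≤ s) {e : Finset V}
    {P : Finset (Finset V)} (he : e ∈ M) (hP : P ⊆ M) (heP : e ∉ P) (hr : P.card = 1)
    (F : MinimalFreeResolution (C.edgeIdeal K ^ s)) : ∃ p, F.deg 1 p = matchingDegree s e P := by
  obtain ⟨f, rfl⟩ := Finset.card_eq_one.1 hr
  have hf : f ∈ M := hP (Finset.mem_singleton_self f)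
  have hJ := @hasMonomial_sub_one_smul_add V K _ C s hs
  refine F.exists_deg_one_eq (hne e he) (hne f hf) ?_ ?_ ?_ ?_
  · intro v hv
    simpa using exists_mem_of_matchingDegree_pos hv
  · convert hJ (hM.1 he) (hM.1 hf) using 1
    simp only [matchingDegree, Finset.sum_singleton, sub_smul, one_smul]
    abel
  · convert hJ (hM.1 he) (hM.1 he) using 1
    simp only [matchingDegree, Finset.sum_singleton, sub_smul, one_smul]
    abel
  · rintro c ⟨h1, h2⟩
    exact hM.not_hasMonomial hne he hP heP h1 (by simpa using h2)

lemma IsInducedMatching.exists_deg_two_eq (hM : C.IsInducedMatching M)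
    (hne : ∀ e ∈ M, e.Nonempty) {s : ℕ} (hs : 1 ≤ s) {e : Finset V}
    {P : Finset (Finset V)} (he : e ∈ M) (hP : P ⊆ M) (heP : e ∉ P) (hr : P.card = 2)
    (F : MinimalFreeResolution (C.edgeIdeal K ^ s)) : ∃ p, F.deg 2 p = matchingDegree s e P := by
  classical
  obtain ⟨f, g, hfg, rfl⟩ := Finset.card_eq_two.1 hr
  have hf : f ∈ M := hP (by simp)
  have hg : g ∈ M := hP (by simp)
  have hJ := @hasMonomial_sub_one_smul_add V K _ C s hs
  refine F.exists_deg_two_eq (hne e he) (hne f hf) (hne g hg) ?_ ?_ ?_ ?_ ?_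
  · intro v hv
    simpa using exists_mem_of_matchingDegree_pos hv
  · convert hJ (hM.1 he) (hM.1 hg) using 1
    simp only [matchingDegree, Finset.sum_pair hfg, sub_smul, one_smul]
    abel
  · convert hJ (hM.1 he) (hM.1 he) using 1
    simp only [matchingDegree, Finset.sum_pair hfg, sub_smul, one_smul]
    abel
  · convert hJ (hM.1 he) (hM.1 hf) using 1
    simp only [matchingDegree, Finset.sum_pair hfg, sub_smul, one_smul]
    abel
  · rintro c ⟨h1, h2, h3⟩
    exact hM.not_hasMonomial hne he hP heP h1 (by simp [h2, h3])

end InducedMatchings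

end Clutter

theorem theorem3p3 {V : Type*} [Fintype V] (K : Type*) [Field K] (C : Clutter V)
    (k t s : ℕ) (hk : C.IsUniform k) (ht : C.inducedMatchingNumber = t) (hs : 2 ≤ s) :
    2 * t.choose 2 ≤
        MonomialResolution.gradedBetti (C.edgeIdeal K ^ s) 1 ((k : ℤ) * s + k) ∧
      3 * t.choose 3 ≤
        MonomialResolution.gradedBetti (C.edgeIdeal K ^ s) 2 ((k : ℤ) * s + 2 * k) := by
  subst ht
  -- Below 2 both binomial coefficients vanish. From 2 on, a maximum induced matching exists and its
  -- edges are nonempty.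
  by_cases h2 : C.inducedMatchingNumber < 2
  · rw [Nat.choose_eq_zero_of_lt h2, Nat.choose_eq_zero_of_lt (h2.trans (by norm_num))]
    simp
  obtain ⟨M, hM, hcard⟩ := Clutter.exists_isInducedMatching_card_eq (C := C) (by omega)
  have hne := hM.nonempty_of_one_lt_card (by omega)
  have hs1 : 1 ≤ s := by omega
  rw [← hcard]
  constructor
  · have := hM.mul_choose_le_gradedBetti (K := K) hne hk hs (r := 1)
      fun e he P hP heP hr => hM.exists_deg_one_eq hne hs1 he hP heP hr
    simpa using this
  · exact hM.mul_choose_le_gradedBetti (K := K) hne hk hs (r := 2)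
      fun e he P hP heP hr => hM.exists_deg_two_eq hne hs1 he hP heP hr
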